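/- Let $\mathbb{R}^\infty=\bigcup_{N\ge 1}\mathbb{R}^N$ be the inner product space of finitely supported real sequences, where $\mathbb{R}^N\subset\mathbb{R}^{M}$ for $N\le M$ by padding with zeros, and let the doubly infinite Grassmannian $\mathrm{Gr}(\infty,\infty)$ be the set of all finite-dimensional subspaces of $\mathbb{R}^\infty$ (of all dimensions, including the zero subspace). For $q\ge 1$ let $\mathcal{L}^q$ be the set of complete linear systems with $q$ variables, i.e. of the linear subspaces $\mathcal{B}$ of $(\mathbb{R}^q)^{\mathbb{N}}$, $\mathbb{N}=\{1,2,\dots\}$, that are closed in the topology of pointwise convergence. The set of finite-horizon linear behaviors is $$\mathcal{L}_{\mathrm{fh}}=\{\mathcal{B}|_{\mathbb{I}} : \mathcal{B}\in\mathcal{L}^q,\ q\ge 1,\ \mathbb{I}\subset\mathbb{N},\ 0<|\mathbb{I}|<\infty\},\qquad \mathcal{B}|_{\mathbb{I}}=\{w|_{\mathbb{I}} : w\in\mathcal{B}\}.$$ The restriction $\mathcal{B}|_{\mathbb{I}}$ with $\mathbb{I}=\{t_1<\dots<t_T\}$ is a subspace of $(\mathbb{R}^q)^{\mathbb{I}}\cong\mathbb{R}^{qT}\subset\mathbb{R}^\infty$,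 via $w\mapsto(w(t_1),\dots,w(t_T))$; so $\mathcal{L}_{\mathrm{fh}}$ is regarded as a subset of $\mathrm{Gr}(\infty,\infty)$. **Theorem.** The restriction to $\mathcal{L}_{\mathrm{fh}}$ of every metric on $\mathrm{Gr}(\infty,\infty)$ is a metric on $\mathcal{L}_{\mathrm{fh}}$. In particular, each of the following is a metric on $\mathcal{L}_{\mathrm{fh}}$, where $k=\dim\mathcal{V}$ and $l=\dim\mathcal{U}$ may differ and $\theta_1\le\dots\le\theta_{\min(k,l)}$ are the principal angles between $\mathcal{V}$ and $\mathcal{U}$ (the arccosines of the singular values of $Q_{\mathcal{U}}^\top Q_{\mathcal{V}}$, where the columns of $Q_{\mathcal{V}}$, $Q_{\mathcal{U}}$ are orthonormal bases of $\mathcal{V}$, $\mathcal{U}$): - the chordal distance $d_\kappa(\mathcal{V},\mathcal{U})=\Bigl(|k-l|+\sum_{i=1}^{\min(k,l)}\sin^2\theta_i\Bigr)^{1/2}$, - the Grassmann distance $d_\gamma(\mathcal{V},\mathcal{U})=\Bigl(|k-l|\tfrac{\pi^2}{4}+\sum_{i=1}^{\min(k,l)}\theta_i^2\Bigr)^{1/2}$,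 - the Procrustes distance $d_\pi(\mathcal{V},\mathcal{U})=\Bigl(|k-l|+2\sum_{i=1}^{\min(k,l)}\sin^2\tfrac{\theta_i}{2}\Bigr)^{1/2}$. -/

import Mathlib

noncomputable section

/-! ### The common ambient space and the doubly infinite Grassmannian -/

/-- `ℝ^∞`, the increasing union of the Euclidean spaces `ℝ^N` under padding by zeros: the finitely
supported real sequences, with the Euclidean inner product (inherited from `ℓ²`). -/
def RInfSubmodule : Submodule ℝ (lp (fun _ : ℕ => ℝ) 2) where
  carrier := {x | (Function.support (x : ℕ → ℝ)).Finite}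
  zero_mem' := by
    refine Set.finite_empty.subset fun n hn => ?_
    exact hn rfl
  add_mem' := by
    intro x y hx hy
    exact (Set.Finite.union hx hy).subset (by
      rw [lp.coeFn_add]; exact Function.support_add _ _)
  smul_mem' := by
    intro c x hx
    exact Set.Finite.subset hx (by
      rw [lp.coeFn_smul]; exact Function.support_const_smul_subset c _)

/-- The inner product space `ℝ^∞`. -/
def RInf : Type := RInfSubmodule

instance : NormedAddCommGroup RInf := inferInstanceAs (NormedAddCommGroup RInfSubmodule)

instance : InnerProductSpace ℝ RInf := inferInstanceAs (InnerProductSpace ℝ RInfSubmodule)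

/-- The sequence `(x₀, …, x_{N-1}, 0, 0, …)`. -/
def padFun {N : ℕ} (x : EuclideanSpace ℝ (Fin N)) (n : ℕ) : ℝ :=
  if h : n < N then x ⟨n, h⟩ else 0

theorem padFun_support_finite {N : ℕ} (x : EuclideanSpace ℝ (Fin N)) :
    (Function.support (padFun x)).Finite := by
  refine (Set.finite_Iio N).subset fun n hn => ?_
  by_contra h
  exact hn (dif_neg h)

theorem padFun_memℓp {N : ℕ} (x : EuclideanSpace ℝ (Fin N)) :
    Memℓp (E := fun _ : ℕ => ℝ) (padFun x) 2 :=
  (memℓp_zero (E := fun _ : ℕ => ℝ) (padFun_support_finite x)).of_exponent_ge bot_le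

/-- The canonical inclusion `ℝ^N → ℝ^∞`, padding by zeros. -/
def pad (N : ℕ) : EuclideanSpace ℝ (Fin N) →ₗ[ℝ] RInf where
  toFun x := ⟨⟨padFun x, padFun_memℓp x⟩, padFun_support_finite x⟩
  map_add' x y := by
    apply Subtype.ext; apply Subtype.ext; funext n
    change padFun (x + y) n = padFun x n + padFun y n
    unfold padFun; split_ifs <;> simp
  map_smul' c x := by
    apply Subtype.ext; apply Subtype.ext; funext n
    change padFun (c • x) n = c * padFun x n
    unfold padFun; split_ifs <;> simp

/-- The doubly infinite Grassmannian `Gr(∞, ∞)`: all finite-dimensional subspaces of `ℝ^∞`.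
A subspace of `ℝ^N` is the same point as its image in `ℝ^M`, `N ≤ M`, under padding by zeros. -/
@[ext]
structure GrInf where
  space : Submodule ℝ RInf
  finiteDimensional : FiniteDimensional ℝ space

instance (V : GrInf) : FiniteDimensional ℝ V.space := V.finiteDimensional

/-- The dimension of a point of `Gr(∞, ∞)`. -/
def GrInf.dim (V : GrInf) : ℕ := Module.finrank ℝ V.space

/-! ### Principal angles and the distances -/

/-- The orthogonal projection onto `U`, restricted to `V`. In orthonormal bases of `V` and `U`,
with matrices `Q_V` and `Q_U`, it is the matrix `Q_Uᵀ Q_V`. -/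
def GrInf.crossProj (V U : GrInf) : V.space →ₗ[ℝ] U.space :=
  U.space.orthogonalProjectionOnto.toLinearMap ∘ₗ V.space.subtype

/-- The principal angles `θ₁ ≤ θ₂ ≤ …` between `V` and `U`, numbered from zero; meaningful for
indices `i < min (dim V) (dim U)`. Their cosines are the singular values of `Q_Uᵀ Q_V`, in
decreasing order. -/
def principalAngle (V U : GrInf) (i : ℕ) : ℝ :=
  Real.arccos ((V.crossProj U).singularValues i)

/-- The chordal distance. -/
def chordalDist (V U : GrInf) : ℝ :=
  Real.sqrt (|(V.dim : ℝ) - (U.dim : ℝ)| +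
    ∑ i ∈ Finset.range (min V.dim U.dim), Real.sin (principalAngle V U i) ^ 2)

/-- The Grassmann distance. -/
def grassmannDist (V U : GrInf) : ℝ :=
  Real.sqrt (|(V.dim : ℝ) - (U.dim : ℝ)| * (Real.pi ^ 2 / 4) +
    ∑ i ∈ Finset.range (min V.dim U.dim), principalAngle V U i ^ 2)

/-- The Procrustes distance. -/
def procrustesDist (V U : GrInf) : ℝ :=
  Real.sqrt (|(V.dim : ℝ) - (U.dim : ℝ)| +
    2 * ∑ i ∈ Finset.range (min V.dim U.dim), Real.sin (principalAngle V U i / 2) ^ 2)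

/-- `d` is a metric on the set (type) `X`. -/
structure IsMetric {X : Type} (d : X → X → ℝ) : Prop where
  nonneg : ∀ x y, 0 ≤ d x y
  eq_zero_iff : ∀ x y, d x y = 0 ↔ x = y
  symm : ∀ x y, d x y = d y x
  triangle : ∀ x y z, d x z ≤ d x y + d y z

/-! ### Finite-horizon linear behaviors -/

/-- The model class `𝓛^q` of complete linear systems with `q` variables and time set the positive
integers: linear subspaces of `(ℝ^q)^ℕ` that are closed in the topology of pointwise convergence. -/
def completeLinearSystems (q : ℕ) : Set (Submodule ℝ (ℕ+ → Fin q → ℝ)) :=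
  {B | IsClosed (B : Set (ℕ+ → Fin q → ℝ))}

/-- The restriction `B|_I = {w|_I : w ∈ B}`, a subspace of `(ℝ^q)^I`. -/
def restrictBehavior {q : ℕ} (B : Submodule ℝ (ℕ+ → Fin q → ℝ)) (I : Finset ℕ+) :
    Submodule ℝ (I → Fin q → ℝ) :=
  B.map (LinearMap.funLeft ℝ (Fin q → ℝ) (Subtype.val : I → ℕ+))

/-- The identification of `(ℝ^q)^I`, `I = {t₁ < … < t_T}`, with `ℝ^{Tq}`:
`w ↦ (w(t₁), …, w(t_T))`, stacked one after the other. -/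
def stack (q : ℕ) (I : Finset ℕ+) :
    (I → Fin q → ℝ) →ₗ[ℝ] EuclideanSpace ℝ (Fin (I.card * q)) where
  toFun w := WithLp.toLp 2 fun n =>
    w (I.orderIsoOfFin rfl (finProdFinEquiv.symm n).1) (finProdFinEquiv.symm n).2
  map_add' _ _ := rfl
  map_smul' _ _ := rfl

/-- A finite-horizon behavior `B|_I` as a point of `Gr(∞, ∞)`. -/
def behaviorPoint {q : ℕ} (B : Submodule ℝ (ℕ+ → Fin q → ℝ)) (I : Finset ℕ+) : GrInf :=
  ⟨(restrictBehavior B I).map (pad (I.card * q) ∘ₗ stack q I), inferInstance⟩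

/-- The set of finite-horizon linear behaviors, as a subset of `Gr(∞, ∞)`. -/
def Lfh : Set GrInf :=
  {V | ∃ q : ℕ, 0 < q ∧ ∃ B ∈ completeLinearSystems q, ∃ I : Finset ℕ+, I.Nonempty ∧
    V = behaviorPoint B I}

end

open scoped RealInnerProductSpace

/-! Restricting a metric to a subset is harmless, so everything rests on the three distances being
metrics on all of `GrInf`, and the hard point is the triangle inequality.

Unequal dimensions are removed first. Inside a finite-dimensional `F` containing all the subspaces,
replace `V` by `augmentation`: add to `V`, in a second orthogonal copy of `F`, the basis vectors of
index at least `dim V`. Every augmented space has dimension `dim F`, half that of `F ⊕ F`. The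
angles between two of them are the old angles, `|k - l|` right angles and zeros; the right angles
produce the `|k - l|` term of each distance. `isMetric_of_principalAngle` thus leaves one triangle
inequality per distance, for half-dimensional subspaces.

Chordal: write `B` and `C` as frames rotated out of `A` by angles `θ` and `ψ`. The squared
cross-Gram entries of the frames are bounded through a doubly stochastic matrix, so Birkhoff's
theorem gives a matching `p` with `∑ sin²(θ i - ψ (p i)) ≤ ∑ sin²(φ i)`, where `φ` are the angles
from `B` to `C`; Minkowski finishes.

Grassmann: the same matching makes the angles to `A` almost 1-Lipschitz for small moves. Cut the
geodesic from `B` to `C` into `n` pieces, add up, and let `n → ∞`.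

Procrustes: the distance is a minimum of Frobenius distances between orthonormal frames, up to a
constant factor; chain optimal frames through `B`. -/

/-- Minkowski's inequality, in the form of a triangle inequality for root sums of squares. -/
theorem sqrt_sum_sq_le_add {ι : Type*} [Fintype ι] (a b c : ι → ℝ)
    (h : ∀ i, |c i| ≤ |a i| + |b i|) :
    √(∑ i, c i ^ 2) ≤ √(∑ i, a i ^ 2) + √(∑ i, b i ^ 2) := by
  have key := norm_add_le (WithLp.toLp 2 (fun i => |a i|) : EuclideanSpace ℝ ι)
    (WithLp.toLp 2 (fun i => |b i|))
  simp only [EuclideanSpace.norm_eq, PiLp.add_apply, Real.norm_eq_abs, abs_abs, sq_abs] at key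
  refine le_trans (Real.sqrt_le_sqrt (Finset.sum_le_sum fun i _ => ?_)) key
  exact sq_le_sq' (by linarith [h i, abs_le.1 (le_refl |c i|)]) ((le_abs_self _).trans (h i))

/-- A linear functional on doubly stochastic matrices dominates its value at some permutation. -/
theorem exists_perm_sum_le {ι : Type*} [Fintype ι] [DecidableEq ι] {M : Matrix ι ι ℝ}
    (hM : M ∈ doublyStochastic ℝ ι) (f : ι → ι → ℝ) :
    ∃ p : Equiv.Perm ι, ∑ i, f i (p i) ≤ ∑ i, ∑ j, M i j * f i j := by
  -- Birkhoff–von Neumann: the matrix is a convex combination of permutation matrices, and a linear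
  -- functional cannot exceed its value at all of them.
  rw [← SetLike.mem_coe, doublyStochastic_eq_convexHull_permMatrix] at hM
  let L : Matrix ι ι ℝ →ₗ[ℝ] ℝ :=
    { toFun := fun M => ∑ i, ∑ j, M i j * f i j
      map_add' := fun A B => by simp [add_mul, Finset.sum_add_distrib]
      map_smul' := fun c A => by simp [Finset.mul_sum, mul_assoc] }
  obtain ⟨_, ⟨p, rfl⟩, hp⟩ :=
    (L.concaveOn convex_univ).exists_le_of_mem_convexHull (Set.subset_univ _) hM
  refine ⟨p, le_trans (le_of_eq ?_) hp⟩
  simp [L, Equiv.Perm.permMatrix, PEquiv.toMatrix_apply]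

/-! ### Principal vectors, rotated frames and geodesics. -/

section Frames

variable {H : Type*} [NormedAddCommGroup H] [InnerProductSpace ℝ H]
  {ι : Type*}

/-- Expansion of an element of the span of an orthonormal family. -/
theorem Orthonormal.sum_inner_smul_eq [Fintype ι] {u : ι → H} (hu : Orthonormal ℝ u) {x : H}
    (hx : x ∈ Submodule.span ℝ (Set.range u)) : ∑ i, ⟪u i, x⟫ • u i = x := by
  obtain ⟨c, rfl⟩ := (Submodule.mem_span_range_iff_exists_fun ℝ).1 hx
  exact Finset.sum_congr rfl fun i _ => by rw [hu.inner_right_fintype]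

/-- Parseval's identity in the span of an orthonormal family. -/
theorem Orthonormal.sum_sq_inner_eq [Fintype ι] {u : ι → H} (hu : Orthonormal ℝ u) {x : H}
    (hx : x ∈ Submodule.span ℝ (Set.range u)) : ∑ i, ⟪u i, x⟫ ^ 2 = ‖x‖ ^ 2 := by
  conv_rhs => rw [← real_inner_self_eq_norm_sq, ← hu.sum_inner_smul_eq hx, hu.inner_sum]
  simp [pow_two]

/-- The Frobenius norm of the cross-Gram matrix does not depend on the second basis. -/
theorem Orthonormal.sum_sq_inner_congr [Fintype ι] {u v : ι → H} (hu : Orthonormal ℝ u)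
    (hv : Orthonormal ℝ v)
    (h : Submodule.span ℝ (Set.range u) = Submodule.span ℝ (Set.range v)) (x : H) :
    ∑ i, ⟪u i, x⟫ ^ 2 = ∑ i, ⟪v i, x⟫ ^ 2 := by
  have : FiniteDimensional ℝ (Submodule.span ℝ (Set.range u)) :=
    FiniteDimensional.span_of_finite ℝ (Set.finite_range u)
  set K := Submodule.span ℝ (Set.range u)
  -- Only the projection of `x` to the common span matters, and Parseval evaluates both sums as its
  -- squared norm.
  have hP : ∀ y ∈ K, ⟪y, x⟫ = ⟪y, K.starProjection x⟫ := fun y hy => by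
    have := K.sub_starProjection_mem_orthogonal x y hy
    rw [inner_sub_right] at this
    linarith
  have hmem : K.starProjection x ∈ K := Submodule.starProjection_apply_mem K x
  have h1 : ∀ i, u i ∈ K := fun i => Submodule.subset_span ⟨i, rfl⟩
  have h2 : ∀ i, v i ∈ K := fun i => h ▸ Submodule.subset_span ⟨i, rfl⟩
  simp_rw [fun i => hP _ (h1 i), fun i => hP _ (h2 i)]
  rw [hu.sum_sq_inner_eq hmem, hv.sum_sq_inner_eq (h ▸ hmem)]

variable [DecidableEq ι]

/-- `θ` is a family of principal angles between the equidimensional subspaces `A` and `B`,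
realized by principal vectors. -/
def PrincipalPair (A B : Submodule ℝ H) (θ : ι → ℝ) : Prop :=
  (∀ i, 0 ≤ θ i ∧ θ i ≤ Real.pi / 2) ∧ ∃ v u : ι → H, Orthonormal ℝ v ∧ Orthonormal ℝ u ∧
    Submodule.span ℝ (Set.range v) = A ∧ Submodule.span ℝ (Set.range u) = B ∧
    ∀ i j, ⟪v i, u j⟫ = if i = j then Real.cos (θ i) else 0

theorem PrincipalPair.symm {A B : Submodule ℝ H} {θ : ι → ℝ} (h : PrincipalPair A B θ) :
    PrincipalPair B A θ := by
  obtain ⟨hθ, v, u, hv, hu, rfl, rfl, hvu⟩ := h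
  refine ⟨hθ, u, v, hu, hv, rfl, rfl, fun i j => ?_⟩
  rw [real_inner_comm, hvu]
  rcases eq_or_ne i j with rfl | hij
  · simp
  · simp [hij, hij.symm]

theorem PrincipalPair.refl_zero {v : ι → H} (hv : Orthonormal ℝ v) :
    PrincipalPair (Submodule.span ℝ (Set.range v)) (Submodule.span ℝ (Set.range v))
      (fun _ : ι => (0 : ℝ)) := by
  refine ⟨fun i => ⟨le_rfl, by positivity⟩, v, v, hv, hv, rfl, rfl, fun i j => ?_⟩
  simp [orthonormal_iff_ite.1 hv i j]

variable [Fintype ι]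

/-- The Frobenius norm of the cross-Gram matrix is invariant under changing either orthonormal
basis, so it may be computed with principal vectors. -/
theorem PrincipalPair.sum_sq_inner {A B : Submodule ℝ H} {θ : ι → ℝ} (h : PrincipalPair A B θ)
    {x y : ι → H} (hx : Orthonormal ℝ x) (hy : Orthonormal ℝ y)
    (hxA : Submodule.span ℝ (Set.range x) = A) (hyB : Submodule.span ℝ (Set.range y) = B) :
    ∑ i, ∑ j, ⟪x i, y j⟫ ^ 2 = ∑ i, Real.cos (θ i) ^ 2 := by
  obtain ⟨hθ, v, u, hv, hu, rfl, rfl, hvu⟩ := h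
  have e1 : ∑ i, ∑ j, ⟪x i, y j⟫ ^ 2 = ∑ i, ∑ j, ⟪v i, y j⟫ ^ 2 := by
    rw [Finset.sum_comm, Finset.sum_comm (f := fun i j => ⟪v i, y j⟫ ^ 2)]
    exact Finset.sum_congr rfl fun j _ => hx.sum_sq_inner_congr hv hxA _
  have e2 : ∀ i, ∑ j, ⟪v i, y j⟫ ^ 2 = ∑ j, ⟪v i, u j⟫ ^ 2 := fun i => by
    simp_rw [real_inner_comm _ (v i)]
    exact hy.sum_sq_inner_congr hu hyB _
  rw [e1]
  refine Finset.sum_congr rfl fun i _ => ?_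
  rw [e2]
  simp [hvu]

/-- The frame `(cos θᵢ) bᵢ + (sin θᵢ) b'ᵢ` obtained by rotating one half of an orthonormal basis
towards the other half. -/
noncomputable def rotatedFrame (b : OrthonormalBasis (ι ⊕ ι) ℝ H) (θ : ι → ℝ) (i : ι) : H :=
  Real.cos (θ i) • b (Sum.inl i) + Real.sin (θ i) • b (Sum.inr i)

theorem inner_rotatedFrame (b : OrthonormalBasis (ι ⊕ ι) ℝ H) (θ φ : ι → ℝ) (i j : ι) :
    ⟪rotatedFrame b θ i, rotatedFrame b φ j⟫ = if i = j then Real.cos (θ i - φ i) else 0 := by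
  have hb := orthonormal_iff_ite.1 b.orthonormal
  simp only [rotatedFrame, inner_add_left, inner_add_right, real_inner_smul_left,
    real_inner_smul_right, hb, Sum.inl.injEq, Sum.inr.injEq, reduceCtorEq, if_false]
  rcases eq_or_ne i j with rfl | hij
  · simp [Real.cos_sub, mul_comm]
  · simp [hij]

theorem orthonormal_rotatedFrame (b : OrthonormalBasis (ι ⊕ ι) ℝ H) (θ : ι → ℝ) :
    Orthonormal ℝ (rotatedFrame b θ) :=
  orthonormal_iff_ite.2 fun i j => by simp [inner_rotatedFrame]

/-- The cosine-sine decomposition of a pair of subspaces of half the dimension. -/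
theorem PrincipalPair.exists_rotatedFrame [FiniteDimensional ℝ H]
    (hd : Module.finrank ℝ H = Fintype.card (ι ⊕ ι)) {A B : Submodule ℝ H} {θ : ι → ℝ}
    (h : PrincipalPair A B θ) :
    ∃ b : OrthonormalBasis (ι ⊕ ι) ℝ H,
      Submodule.span ℝ (Set.range fun i => b (Sum.inl i)) = A ∧
      Submodule.span ℝ (Set.range (rotatedFrame b θ)) = B := by
  obtain ⟨hθ, v, u, hv, hu, rfl, rfl, hvu⟩ := h
  have hv' := orthonormal_iff_ite.1 hv
  have hu' := orthonormal_iff_ite.1 hu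
  have huv : ∀ i j, ⟪u i, v j⟫ = if i = j then Real.cos (θ i) else 0 := fun i j => by
    rw [real_inner_comm, hvu]
    rcases eq_or_ne i j with rfl | hij
    · simp
    · simp [hij, hij.symm]
  let f : ι ⊕ ι → H := Sum.elim v fun i => (Real.sin (θ i))⁻¹ • (u i - Real.cos (θ i) • v i)
  -- Where `sin (θ i) = 0` the quotient defining `f` is meaningless; those indices are left to the
  -- extension to an orthonormal basis.
  let s : Set (ι ⊕ ι) := {x | ∀ i, x = Sum.inr i → Real.sin (θ i) ≠ 0}
  have hf : Orthonormal ℝ (s.domRestrict f) := by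
    rw [orthonormal_iff_ite]
    rintro ⟨i | i, hi⟩ ⟨j | j, hj⟩
    · simp [f, hv']
    · simp only [Set.domRestrict_apply, f, Sum.elim_inl, Sum.elim_inr, real_inner_smul_right,
        inner_sub_right, hvu, hv', Subtype.mk.injEq, reduceCtorEq, if_false]
      rcases eq_or_ne i j with rfl | hij
      · simp
      · simp [hij]
    · simp only [Set.domRestrict_apply, f, Sum.elim_inl, Sum.elim_inr, real_inner_smul_left,
        inner_sub_left, huv, hv', Subtype.mk.injEq, reduceCtorEq, if_false]
      rcases eq_or_ne i j with rfl | hij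
      · simp
      · simp [hij]
    · have hi' := hi i rfl
      simp only [Set.domRestrict_apply, f, Sum.elim_inr, real_inner_smul_left,
        inner_sub_left, real_inner_smul_right, inner_sub_right, huv, hvu, hv', hu',
        Subtype.mk.injEq, Sum.inr.injEq]
      rcases eq_or_ne i j with rfl | hij
      · simp only [if_true, mul_one, sub_self]
        have := Real.sin_sq_add_cos_sq (θ i)
        field_simp
        linarith
      · simp [hij]
  obtain ⟨b, hb⟩ := hf.exists_orthonormalBasis_extension_of_card_eq hd
  have hbl : ∀ i, b (Sum.inl i) = v i := fun i => hb (Sum.inl i) (fun j hj => by simp at hj)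
  refine ⟨b, by simp_rw [hbl], ?_⟩
  suffices hR : rotatedFrame b θ = u by rw [hR]
  funext i
  rw [rotatedFrame, hbl]
  by_cases hi : Real.sin (θ i) = 0
  · have hc : Real.cos (θ i) = 1 := by
      have h1 : 0 ≤ Real.cos (θ i) :=
        Real.cos_nonneg_of_mem_Icc ⟨by linarith [(hθ i).1, Real.pi_pos], (hθ i).2⟩
      have := Real.sin_sq_add_cos_sq (θ i)
      rw [hi] at this
      nlinarith
    rw [hi, hc, one_smul, zero_smul, add_zero]
    refine (inner_eq_one_iff_of_norm_eq_one (𝕜 := ℝ) (hv.1 i) (hu.1 i)).1 ?_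
    rw [hvu, if_pos rfl, hc]
  · rw [hb (Sum.inr i) (fun j hj => by cases hj; exact hi)]
    simp only [f, Sum.elim_inr, smul_smul, mul_inv_cancel₀ hi, one_smul]
    abel

/-- The geodesic between two subspaces of half the dimension. -/
theorem PrincipalPair.exists_geodesic [FiniteDimensional ℝ H]
    (hd : Module.finrank ℝ H = Fintype.card (ι ⊕ ι)) {A B : Submodule ℝ H} {θ : ι → ℝ}
    (h : PrincipalPair A B θ) :
    ∃ G : ℝ → Submodule ℝ H, G 0 = A ∧ G 1 = B ∧
      (∀ s, ∃ u : ι → H, Orthonormal ℝ u ∧ Submodule.span ℝ (Set.range u) = G s) ∧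
      ∀ s t, s ≤ t → t ≤ s + 1 → PrincipalPair (G s) (G t) (fun i => (t - s) * θ i) := by
  obtain ⟨b, hA, hB⟩ := h.exists_rotatedFrame hd
  refine ⟨fun s => Submodule.span ℝ (Set.range (rotatedFrame b fun i => s * θ i)), ?_, ?_,
    fun s => ⟨_, orthonormal_rotatedFrame b _, rfl⟩, fun s t hst hts => ?_⟩
  · have : (rotatedFrame b fun i => 0 * θ i) = fun i => b (Sum.inl i) := by
      funext i
      simp [rotatedFrame]
    rw [← hA, ← this]
  · simpa using hB
  · refine ⟨fun i => ⟨mul_nonneg (by linarith) (h.1 i).1, ?_⟩, _, _, orthonormal_rotatedFrame b _,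
      orthonormal_rotatedFrame b _, rfl, rfl, fun i j => ?_⟩
    · have := h.1 i
      nlinarith
    · rw [inner_rotatedFrame, ← Real.cos_neg]
      congr 2
      ring

end Frames

/-! ### Chordal and Procrustes triangle inequalities in equal dimensions. -/

section Triangle

variable {H : Type*} [NormedAddCommGroup H] [InnerProductSpace ℝ H]
  {ι : Type*} [DecidableEq ι] [Fintype ι]

/-- Cauchy–Schwarz with weights `c * c'` and `s * s'`: the two sides differ by `c * c' * (s * s') *
(a - b) ^ 2`. For cosines and sines the total weight is the cosine of the difference. -/
theorem sq_add_le_cos_sub {c s c' s' a b : ℝ} (hc : 0 ≤ c * c') (hs : 0 ≤ s * s') :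
    (c * c' * a + s * s' * b) ^ 2 ≤
      (c * c' + s * s') * (c * c' * a ^ 2 + s * s' * b ^ 2) := by
  nlinarith [mul_nonneg (mul_nonneg hc hs) (sq_nonneg (a - b))]

/-- If `U` and `U'` make angles `θ` and `ψ` with the same half-dimensional subspace, then, for a
suitable matching, the chordal distance of `U` and `U'` dominates that of the angles. -/
theorem PrincipalPair.exists_perm_sum_sin_sq_le [FiniteDimensional ℝ H]
    (hd : Module.finrank ℝ H = Fintype.card (ι ⊕ ι)) {A B C : Submodule ℝ H} {θ ψ φ : ι → ℝ}
    (hAB : PrincipalPair A B θ) (hAC : PrincipalPair A C ψ) (hBC : PrincipalPair B C φ) :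
    ∃ p : Equiv.Perm ι,
      ∑ i, Real.sin (θ i - ψ (p i)) ^ 2 ≤ ∑ i, Real.sin (φ i) ^ 2 := by
  obtain ⟨b, hbA, hbB⟩ := hAB.exists_rotatedFrame hd
  obtain ⟨b', hbA', hbC⟩ := hAC.exists_rotatedFrame hd
  have hbo := orthonormal_iff_ite.1 b.orthonormal
  have hbo' := orthonormal_iff_ite.1 b'.orthonormal
  -- The left halves of `b` and `b'` both span `A`, so the change of basis is block diagonal, with
  -- orthogonal blocks `P` and `Q`.
  have hlr : ∀ i j, ⟪b (Sum.inl i), b' (Sum.inr j)⟫ = 0 := fun i j => by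
    have hm : b (Sum.inl i) ∈ Submodule.span ℝ (Set.range fun i => b' (Sum.inl i)) := by
      rw [hbA', ← hbA]
      exact Submodule.subset_span ⟨i, rfl⟩
    obtain ⟨c, hc⟩ := (Submodule.mem_span_range_iff_exists_fun ℝ).1 hm
    rw [← hc, sum_inner]
    simp [real_inner_smul_left, hbo']
  have hrl : ∀ i j, ⟪b (Sum.inr i), b' (Sum.inl j)⟫ = 0 := fun i j => by
    have hm : b' (Sum.inl j) ∈ Submodule.span ℝ (Set.range fun i => b (Sum.inl i)) := by
      rw [hbA, ← hbA']
      exact Submodule.subset_span ⟨j, rfl⟩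
    obtain ⟨c, hc⟩ := (Submodule.mem_span_range_iff_exists_fun ℝ).1 hm
    rw [← hc, inner_sum]
    simp [real_inner_smul_right, hbo]
  set P : ι → ι → ℝ := fun i j => ⟪b (Sum.inl i), b' (Sum.inl j)⟫ with hP
  set Q : ι → ι → ℝ := fun i j => ⟪b (Sum.inr i), b' (Sum.inr j)⟫ with hQ
  have hProw : ∀ i, ∑ j, P i j ^ 2 = 1 := fun i => by
    have := b'.sum_sq_inner_left (b (Sum.inl i))
    simpa [hlr, b.norm_eq_one] using this
  have hPcol : ∀ j, ∑ i, P i j ^ 2 = 1 := fun j => by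
    have := b.sum_sq_inner_right (b' (Sum.inl j))
    simpa [hrl, b'.norm_eq_one] using this
  have hQrow : ∀ i, ∑ j, Q i j ^ 2 = 1 := fun i => by
    have := b'.sum_sq_inner_left (b (Sum.inr i))
    simpa [hrl, b.norm_eq_one] using this
  have hQcol : ∀ j, ∑ i, Q i j ^ 2 = 1 := fun j => by
    have := b.sum_sq_inner_right (b' (Sum.inr j))
    simpa [hlr, b'.norm_eq_one] using this
  have hinner : ∀ i j, ⟪rotatedFrame b θ i, rotatedFrame b' ψ j⟫ =
      Real.cos (θ i) * Real.cos (ψ j) * P i j + Real.sin (θ i) * Real.sin (ψ j) * Q i j := by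
    intro i j
    simp only [rotatedFrame, inner_add_left, inner_add_right, real_inner_smul_left,
      real_inner_smul_right, hlr, hrl, hP, hQ]
    ring
  have hcos : ∀ {x : ℝ}, 0 ≤ x ∧ x ≤ Real.pi / 2 → 0 ≤ Real.cos x := fun hx =>
    Real.cos_nonneg_of_mem_Icc ⟨by linarith [hx.1, Real.pi_pos], hx.2⟩
  have hsin : ∀ {x : ℝ}, 0 ≤ x ∧ x ≤ Real.pi / 2 → 0 ≤ Real.sin x := fun hx =>
    Real.sin_nonneg_of_nonneg_of_le_pi hx.1 (by linarith [hx.2, Real.pi_pos])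
  -- The entrywise squares of an orthogonal matrix are doubly stochastic; `M` averages two such
  -- matrices.
  let M : Matrix ι ι ℝ := fun i j => (P i j ^ 2 + Q i j ^ 2) / 2
  have hMrow : ∀ i, ∑ j, M i j = 1 := fun i => by
    simp only [M, ← Finset.sum_div, Finset.sum_add_distrib, hProw, hQrow]
    norm_num
  have hMcol : ∀ j, ∑ i, M i j = 1 := fun j => by
    simp only [M, ← Finset.sum_div, Finset.sum_add_distrib, hPcol, hQcol]
    norm_num
  have hM : M ∈ doublyStochastic ℝ ι :=
    mem_doublyStochastic_iff_sum.2 ⟨fun i j => by positivity, hMrow, hMcol⟩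
  obtain ⟨p, hp⟩ := exists_perm_sum_le hM fun i j => Real.sin (θ i - ψ j) ^ 2
  refine ⟨p, hp.trans ?_⟩
  -- The product formulas for `cos * cos` and `sin * sin` turn the Cauchy–Schwarz bound into `M i j
  -- * cos²(θ i - ψ j)` plus two corrections, each depending on one angle only. These cancel on
  -- summation because `P²` and `Q²` have equal row and column sums.
  have hterm : ∀ i j, ⟪rotatedFrame b θ i, rotatedFrame b' ψ j⟫ ^ 2 ≤
      M i j - M i j * Real.sin (θ i - ψ j) ^ 2 +
        (P i j ^ 2 - Q i j ^ 2) * (Real.cos (2 * θ i) / 4) +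
        (P i j ^ 2 - Q i j ^ 2) * (Real.cos (2 * ψ j) / 4) := by
    intro i j
    rw [hinner]
    refine (sq_add_le_cos_sub (mul_nonneg (hcos (hAB.1 i)) (hcos (hAC.1 j)))
      (mul_nonneg (hsin (hAB.1 i)) (hsin (hAC.1 j)))).trans (le_of_eq ?_)
    simp only [M]
    rw [Real.sin_sq, Real.cos_sub, Real.cos_two_mul, Real.cos_two_mul]
    have h1 := Real.sin_sq_add_cos_sq (θ i)
    have h2 := Real.sin_sq_add_cos_sq (ψ j)
    linear_combination (Q i j ^ 2 - P i j ^ 2) / 2 * (Real.sin (ψ j) ^ 2 * h1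
      + (1 - Real.cos (θ i) ^ 2) * h2)
  have hsum := Finset.sum_le_sum fun i (_ : i ∈ Finset.univ) =>
    Finset.sum_le_sum fun j (_ : j ∈ Finset.univ) => hterm i j
  rw [hBC.sum_sq_inner (orthonormal_rotatedFrame b θ) (orthonormal_rotatedFrame b' ψ) hbB hbC]
    at hsum
  have z1 : ∑ i, ∑ j, (P i j ^ 2 - Q i j ^ 2) * (Real.cos (2 * θ i) / 4) = 0 :=
    Finset.sum_eq_zero fun i _ => by
      rw [← Finset.sum_mul, Finset.sum_sub_distrib, hProw, hQrow]
      ring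
  have z2 : ∑ i, ∑ j, (P i j ^ 2 - Q i j ^ 2) * (Real.cos (2 * ψ j) / 4) = 0 := by
    rw [Finset.sum_comm]
    refine Finset.sum_eq_zero fun j _ => ?_
    rw [← Finset.sum_mul, Finset.sum_sub_distrib, hPcol, hQcol]
    ring
  simp only [Finset.sum_add_distrib, Finset.sum_sub_distrib, z1, z2, hMrow, add_zero] at hsum
  simp only [Real.sin_sq (φ _), Finset.sum_sub_distrib]
  linarith

theorem PrincipalPair.chordal_triangle [FiniteDimensional ℝ H]
    (hd : Module.finrank ℝ H = Fintype.card (ι ⊕ ι)) {A B C : Submodule ℝ H} {θ ψ φ : ι → ℝ}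
    (hAB : PrincipalPair A B θ) (hBC : PrincipalPair B C φ) (hAC : PrincipalPair A C ψ) :
    √(∑ i, Real.sin (ψ i) ^ 2) ≤ √(∑ i, Real.sin (θ i) ^ 2) + √(∑ i, Real.sin (φ i) ^ 2) := by
  obtain ⟨p, hp⟩ := hAB.exists_perm_sum_sin_sq_le hd hAC hBC
  rw [← Equiv.sum_comp p fun i => Real.sin (ψ i) ^ 2]
  refine (sqrt_sum_sq_le_add (fun i => Real.sin (θ i)) (fun i => Real.sin (θ i - ψ (p i))) _
    fun i => ?_).trans (by gcongr)
  have h : ψ (p i) = θ i - (θ i - ψ (p i)) := by ring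
  rw [h, Real.sin_sub, ← h]
  refine (abs_sub _ _).trans ?_
  rw [abs_mul, abs_mul]
  gcongr
  · exact mul_le_of_le_one_right (abs_nonneg _) (Real.abs_cos_le_one _)
  · exact mul_le_of_le_one_left (abs_nonneg _) (Real.abs_cos_le_one _)

/-- Half of the squared Procrustes distance is minimal at principal vectors. -/
theorem PrincipalPair.sum_inner_le {A B : Submodule ℝ H} {θ : ι → ℝ} (h : PrincipalPair A B θ)
    {x y : ι → H} (hx : Orthonormal ℝ x) (hy : Orthonormal ℝ y)
    (hxA : ∀ i, x i ∈ A) (hyB : ∀ i, y i ∈ B) :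
    ∑ i, ⟪x i, y i⟫ ≤ ∑ i, Real.cos (θ i) := by
  obtain ⟨hθ, v, u, hv, hu, rfl, rfl, hvu⟩ := h
  -- Expanding in principal vectors gives `cos (θ j)` the weight `∑ i, ⟪x i, v j⟫ * ⟪y i, u j⟫`, at
  -- most `1` by Bessel and `2ab ≤ a² + b²`.
  have hxy : ∀ i, ⟪x i, y i⟫ = ∑ j, Real.cos (θ j) * (⟪x i, v j⟫ * ⟪y i, u j⟫) := fun i => by
    conv_lhs => rw [← hv.sum_inner_smul_eq (hxA i), ← hu.sum_inner_smul_eq (hyB i)]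
    simp only [sum_inner, inner_sum, real_inner_smul_left, real_inner_smul_right, hvu]
    refine Finset.sum_congr rfl fun j _ => ?_
    simp only [mul_ite, mul_zero, Finset.sum_ite_eq', Finset.mem_univ, if_true,
      real_inner_comm (x i), real_inner_comm (y i)]
    ring
  simp_rw [hxy]
  rw [Finset.sum_comm]
  refine Finset.sum_le_sum fun j _ => ?_
  rw [← Finset.mul_sum]
  have h1 : ∑ i, ⟪x i, v j⟫ ^ 2 ≤ 1 := by
    simpa [hv.1 j] using hx.sum_inner_products_le (v j) (s := Finset.univ)
  have h2 : ∑ i, ⟪y i, u j⟫ ^ 2 ≤ 1 := by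
    simpa [hu.1 j] using hy.sum_inner_products_le (u j) (s := Finset.univ)
  refine mul_le_of_le_one_right (Real.cos_nonneg_of_mem_Icc
    ⟨by linarith [(hθ j).1, Real.pi_pos], (hθ j).2⟩) ?_
  calc ∑ i, ⟪x i, v j⟫ * ⟪y i, u j⟫ ≤ ∑ i, (⟪x i, v j⟫ ^ 2 / 2 + ⟪y i, u j⟫ ^ 2 / 2) :=
        Finset.sum_le_sum fun i _ => by nlinarith [sq_nonneg (⟪x i, v j⟫ - ⟪y i, u j⟫)]
    _ ≤ 1 := by
        rw [Finset.sum_add_distrib, ← Finset.sum_div, ← Finset.sum_div]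
        linarith

theorem PrincipalPair.procrustes_triangle {A B C : Submodule ℝ H} {θ ψ φ : ι → ℝ}
    (hAB : PrincipalPair A B θ) (hBC : PrincipalPair B C φ) (hAC : PrincipalPair A C ψ) :
    √(∑ i, 2 * Real.sin (ψ i / 2) ^ 2) ≤
      √(∑ i, 2 * Real.sin (θ i / 2) ^ 2) + √(∑ i, 2 * Real.sin (φ i / 2) ^ 2) := by
  obtain ⟨hθ, a, b, ha, hb, rfl, rfl, hab⟩ := hAB
  obtain ⟨hφ, b', c, hb', hc, hBB, rfl, hbc⟩ := hBC
  have hbb : ∀ i, b' i ∈ Submodule.span ℝ (Set.range b) := fun i => by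
    rw [← hBB]
    exact Submodule.subset_span ⟨i, rfl⟩
  have hbexp := fun i => hb.sum_inner_smul_eq (hbb i)
  -- The image of `b'` under the isometry `b j ↦ a j` from `B` to `A`. The pair `x, b'` is still
  -- optimal for `A, B`, `b', c` is optimal for `B, C`, and `x, c` competes for `A, C`.
  let x : ι → H := fun i => ∑ j, ⟪b j, b' i⟫ • a j
  have hxb : ∀ i, ⟪x i, b' i⟫ = ∑ j, Real.cos (θ j) * ⟪b' i, b j⟫ ^ 2 := fun i => by
    conv_lhs => rw [← hbexp i]
    simp only [x, sum_inner, inner_sum, real_inner_smul_left, real_inner_smul_right, hab]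
    refine Finset.sum_congr rfl fun j _ => ?_
    simp only [mul_ite, mul_zero, Finset.sum_ite_eq', Finset.mem_univ, if_true,
      real_inner_comm (b' i)]
    ring
  have hx : Orthonormal ℝ x := by
    rw [orthonormal_iff_ite]
    intro i j
    rw [← orthonormal_iff_ite.1 hb' i j]
    conv_rhs => rw [← hbexp i, ← hbexp j]
    simp only [x, hb.inner_sum, ha.inner_sum]
  have hdist : ∀ {u v : H}, ‖u‖ = 1 → ‖v‖ = 1 → ‖u - v‖ ^ 2 = 2 * (1 - ⟪u, v⟫) := by
    intro u v hu hv
    rw [norm_sub_sq_real, hu, hv]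
    ring
  have hhalf : ∀ t : ℝ, 2 * Real.sin (t / 2) ^ 2 = 1 - Real.cos t := fun t => by
    rw [Real.sin_sq_eq_half_sub, mul_div_cancel₀ t two_ne_zero]
    ring
  have hsc : ∀ w : ι → ℝ, √(∑ i, 2 * w i) = √2 * √(∑ i, w i) := fun w => by
    rw [← Finset.mul_sum, Real.sqrt_mul zero_le_two]
  have key := sqrt_sum_sq_le_add (fun i => ‖x i - b' i‖) (fun i => ‖b' i - c i‖)
    (fun i => ‖x i - c i‖) fun i => by
      simpa using norm_sub_le_norm_sub_add_norm_sub (x i) (b' i) (c i)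
  simp only [hdist (hx.1 _) (hb'.1 _), hdist (hb'.1 _) (hc.1 _), hdist (hx.1 _) (hc.1 _), hsc,
    ← mul_add] at key
  replace key := le_of_mul_le_mul_left key (by positivity)
  have h1 : ∑ i, (1 - ⟪x i, b' i⟫) = ∑ i, (1 - Real.cos (θ i)) := by
    simp only [Finset.sum_sub_distrib, hxb]
    congr 1
    rw [Finset.sum_comm]
    refine Finset.sum_congr rfl fun j _ => ?_
    rw [← Finset.mul_sum, hb'.sum_sq_inner_eq, hb.1 j]
    · ring
    · rw [hBB]
      exact Submodule.subset_span ⟨j, rfl⟩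
  have h2 : ∑ i, (1 - ⟪b' i, c i⟫) = ∑ i, (1 - Real.cos (φ i)) := by simp [hbc]
  have h3 : ∑ i, (1 - Real.cos (ψ i)) ≤ ∑ i, (1 - ⟪x i, c i⟫) := by
    simp only [Finset.sum_sub_distrib]
    refine sub_le_sub_left (hAC.sum_inner_le hx hc (fun i => ?_) fun i =>
      Submodule.subset_span ⟨i, rfl⟩) _
    exact Submodule.sum_mem _ fun j _ =>
      Submodule.smul_mem _ _ (Submodule.subset_span ⟨j, rfl⟩)
  simp only [hhalf]
  rw [h1, h2] at key
  exact (Real.sqrt_le_sqrt h3).trans key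

end Triangle

/-! ### Existence of principal vectors from the singular value decomposition. -/

section SingularValueDecomposition

/-- The singular value decomposition of a linear map between finite-dimensional spaces. -/
theorem LinearMap.exists_singularValueDecomposition {X Y : Type*}
    [NormedAddCommGroup X] [InnerProductSpace ℝ X] [FiniteDimensional ℝ X]
    [NormedAddCommGroup Y] [InnerProductSpace ℝ Y] [FiniteDimensional ℝ Y] (T : X →ₗ[ℝ] Y) :
    ∃ (v : OrthonormalBasis (Fin (Module.finrank ℝ X)) ℝ X)
      (u : OrthonormalBasis (Fin (Module.finrank ℝ Y)) ℝ Y),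
      ∀ i j, ⟪T (v i), u j⟫ = if (i : ℕ) = j then T.singularValues i else 0 := by
  set k := Module.finrank ℝ X with hk
  set l := Module.finrank ℝ Y with hl
  set v := T.isSymmetric_adjoint_comp_self.eigenvectorBasis hk.symm with hv
  have hvo := orthonormal_iff_ite.1 v.orthonormal
  have hTT : ∀ i j, ⟪T (v i), T (v j)⟫ = if i = j then T.singularValues i ^ 2 else 0 := by
    intro i j
    rw [← LinearMap.adjoint_inner_left]
    have := T.isSymmetric_adjoint_comp_self.apply_eigenvectorBasis hk.symm i
    rw [LinearMap.comp_apply] at this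
    rw [this, real_inner_smul_left, hvo, T.sq_singularValues_fin hk.symm]
    simp
  have hzero : ∀ i : Fin k, T.singularValues i = 0 → T (v i) = 0 := fun i hi => by
    rw [← inner_self_eq_zero (𝕜 := ℝ), hTT, if_pos rfl, hi]
    norm_num
  have hlt : ∀ i : ℕ, T.singularValues i ≠ 0 → i < l := fun i hi => by
    rw [← T.singularValues_pos_iff_ne_zero, T.singularValues_pos_iff_lt_finrank_range] at hi
    exact hi.trans_le (Submodule.finrank_le _)
  have hltk : ∀ i : ℕ, T.singularValues i ≠ 0 → i < k := fun i hi => by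
    by_contra h
    exact hi (T.singularValues_of_finrank_le (not_lt.1 h))
  -- Normalized images of the right singular vectors; the value `0` is never used, since `s` keeps
  -- only nonzero singular values, whose indices are below `k`.
  let f : Fin l → Y := fun j =>
    if h : (j : ℕ) < k then (T.singularValues j)⁻¹ • T (v ⟨j, h⟩) else 0
  let s : Set (Fin l) := {j | T.singularValues j ≠ 0}
  have hf : Orthonormal ℝ (s.domRestrict f) := by
    rw [orthonormal_iff_ite]
    rintro ⟨i, hi⟩ ⟨j, hj⟩
    have hi' : T.singularValues i ≠ 0 := hi
    have hj' : T.singularValues j ≠ 0 := hj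
    simp only [Set.domRestrict_apply, f, dif_pos (hltk _ hi'), dif_pos (hltk _ hj'),
      real_inner_smul_left, real_inner_smul_right, hTT, Subtype.mk.injEq, Fin.ext_iff]
    split_ifs with hij
    · rw [← hij]
      field_simp
    · simp
  obtain ⟨u, hu⟩ := hf.exists_orthonormalBasis_extension_of_card_eq (by simp [hl])
  have huo := orthonormal_iff_ite.1 u.orthonormal
  refine ⟨v, u, fun i j => ?_⟩
  by_cases hi : T.singularValues i = 0
  · rw [hzero i hi, inner_zero_left, hi, ite_self]
  · have hTv : T (v i) = T.singularValues i • u ⟨i, hlt _ hi⟩ := by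
      rw [hu ⟨i, hlt _ hi⟩ hi]
      simp [f, smul_smul, mul_inv_cancel₀ hi]
    rw [hTv, real_inner_smul_left, huo]
    simp [Fin.ext_iff]

variable {E : Type*} [NormedAddCommGroup E] [InnerProductSpace ℝ E]

/-- Principal vectors of a pair of finite-dimensional subspaces. -/
theorem Submodule.exists_principalVectors (V U : Submodule ℝ E) [FiniteDimensional ℝ V]
    [FiniteDimensional ℝ U] :
    ∃ (v : OrthonormalBasis (Fin (Module.finrank ℝ V)) ℝ V)
      (u : OrthonormalBasis (Fin (Module.finrank ℝ U)) ℝ U),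
      ∀ i j, ⟪(v i : E), (u j : E)⟫ = if (i : ℕ) = j then
        (U.orthogonalProjectionOnto.toLinearMap ∘ₗ V.subtype).singularValues i else 0 := by
  obtain ⟨v, u, h⟩ := LinearMap.exists_singularValueDecomposition
    (U.orthogonalProjectionOnto.toLinearMap ∘ₗ V.subtype)
  refine ⟨v, u, fun i j => ?_⟩
  rw [← h]
  simp

theorem OrthonormalBasis.orthonormal_coe {ι : Type*} [Fintype ι] {V : Submodule ℝ E}
    (v : OrthonormalBasis ι ℝ V) : Orthonormal ℝ fun i => (v i : E) :=
  v.orthonormal.comp_linearIsometry V.subtypeₗᵢ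

theorem OrthonormalBasis.span_coe {ι : Type*} [Fintype ι] {V : Submodule ℝ E}
    (v : OrthonormalBasis ι ℝ V) : Submodule.span ℝ (Set.range fun i => (v i : E)) = V := by
  have : (fun i => (v i : E)) = V.subtype ∘ v := rfl
  rw [this, Set.range_comp, Submodule.span_image, ← v.coe_toBasis, v.toBasis.span_eq,
    Submodule.map_top, Submodule.range_subtype]

theorem arccos_mem_of_nonneg {x : ℝ} (hx : 0 ≤ x) :
    0 ≤ Real.arccos x ∧ Real.arccos x ≤ Real.pi / 2 :=
  ⟨Real.arccos_nonneg x, Real.arccos_le_pi_div_two.2 hx⟩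

/-- A nonzero singular value is an inner product of two unit principal vectors. -/
theorem singularValues_projection_le_one (V U : Submodule ℝ E) [FiniteDimensional ℝ V]
    [FiniteDimensional ℝ U] (i : ℕ) :
    (U.orthogonalProjectionOnto.toLinearMap ∘ₗ V.subtype).singularValues i ≤ 1 := by
  set T := U.orthogonalProjectionOnto.toLinearMap ∘ₗ V.subtype
  by_cases hi : T.singularValues i = 0
  · rw [hi]
    exact zero_le_one
  obtain ⟨v, u, h⟩ := Submodule.exists_principalVectors V U
  have hik : i < Module.finrank ℝ V := by
    by_contra hlt
    exact hi (T.singularValues_of_finrank_le (not_lt.1 hlt))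
  have hil : i < Module.finrank ℝ U := by
    rw [← ne_eq, ← T.singularValues_pos_iff_ne_zero,
      T.singularValues_pos_iff_lt_finrank_range] at hi
    exact hi.trans_le (Submodule.finrank_le _)
  have h1 := h ⟨i, hik⟩ ⟨i, hil⟩
  rw [if_pos rfl] at h1
  rw [← h1]
  refine (real_inner_le_norm _ _).trans (le_of_eq ?_)
  rw [v.orthonormal_coe.1, u.orthonormal_coe.1, one_mul]

theorem exists_principalPair {ι : Type*} [Fintype ι] [DecidableEq ι] {v u : ι → E}
    (hv : Orthonormal ℝ v) (hu : Orthonormal ℝ u) :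
    ∃ θ : ι → ℝ, PrincipalPair (Submodule.span ℝ (Set.range v))
      (Submodule.span ℝ (Set.range u)) θ := by
  set V := Submodule.span ℝ (Set.range v) with hV
  set U := Submodule.span ℝ (Set.range u) with hU
  have : FiniteDimensional ℝ V := FiniteDimensional.span_of_finite ℝ (Set.finite_range v)
  have : FiniteDimensional ℝ U := FiniteDimensional.span_of_finite ℝ (Set.finite_range u)
  have hVc : Module.finrank ℝ V = Fintype.card ι := finrank_span_eq_card hv.linearIndependent
  have hUc : Module.finrank ℝ U = Fintype.card ι := finrank_span_eq_card hu.linearIndependent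
  obtain ⟨x, y, h⟩ := Submodule.exists_principalVectors V U
  set T := U.orthogonalProjectionOnto.toLinearMap ∘ₗ V.subtype
  let e := Fintype.equivFin ι
  let x' := x.reindex ((finCongr hVc).trans e.symm)
  let y' := y.reindex ((finCongr hUc).trans e.symm)
  refine ⟨fun i => Real.arccos (T.singularValues (e i)),
    fun i => arccos_mem_of_nonneg (T.singularValues_nonneg _), fun i => x' i, fun i => y' i,
    x'.orthonormal_coe, y'.orthonormal_coe, x'.span_coe, y'.span_coe, fun i j => ?_⟩
  rw [Real.cos_arccos (by linarith [T.singularValues_nonneg (e i)])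
    (singularValues_projection_le_one V U _)]
  simp [x', y', h, T, ← Fin.ext_iff]

end SingularValueDecomposition

/-! ### Grassmann triangle inequality by subdividing a geodesic. -/

section GrassmannTriangle

open Filter Topology

variable {H : Type*} [NormedAddCommGroup H] [InnerProductSpace ℝ H] [FiniteDimensional ℝ H]
  {ι : Type*} [DecidableEq ι] [Fintype ι]

/-- Jordan's inequality turns the bound on the sine into `|x| ≤ π / 2 * e`; then `|x| ≤ tan |x|` and
monotonicity of the cosine apply. The factor tends to `1` as `e → 0`. -/
theorem abs_mul_cos_le_abs_sin {x e : ℝ} (hx : |x| ≤ Real.pi / 2) (he : |Real.sin x| ≤ e)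
    (he1 : e < 1) : |x| * Real.cos (Real.pi / 2 * e) ≤ |Real.sin x| := by
  have hpi := Real.pi_pos
  have hs : |Real.sin x| = Real.sin |x| := by
    rcases le_total 0 x with h | h
    · rw [abs_of_nonneg h, abs_of_nonneg]
      exact Real.sin_nonneg_of_nonneg_of_le_pi h (by linarith [le_abs_self x])
    · rw [abs_of_nonpos h, Real.sin_neg, abs_of_nonpos]
      exact Real.sin_nonpos_of_nonpos_of_neg_pi_le h (by linarith [neg_abs_le x])
  rw [hs] at he ⊢
  have h1 : |x| ≤ Real.pi / 2 * e := by
    have := (Real.mul_le_sin (abs_nonneg x) hx).trans he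
    rw [div_mul_eq_mul_div, div_le_iff₀ hpi] at this
    linarith
  have hlt : |x| < Real.pi / 2 := by nlinarith
  have h2 := Real.le_tan (abs_nonneg x) hlt
  have hc : 0 < Real.cos |x| := Real.cos_pos_of_mem_Ioo ⟨by linarith [abs_nonneg x], hlt⟩
  rw [Real.tan_eq_sin_div_cos, le_div_iff₀ hc] at h2
  refine le_trans (mul_le_mul_of_nonneg_left ?_ (abs_nonneg x)) h2
  exact Real.cos_le_cos_of_nonneg_of_le_pi (abs_nonneg x) (by nlinarith) h1

/-- The principal angles depend in an almost `1`-Lipschitz way on one of the subspaces. -/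
theorem PrincipalPair.sqrt_sum_sq_mul_cos_le
    (hd : Module.finrank ℝ H = Fintype.card (ι ⊕ ι)) {A B C : Submodule ℝ H} {θ ψ φ : ι → ℝ}
    (hAB : PrincipalPair A B θ) (hAC : PrincipalPair A C ψ) (hBC : PrincipalPair B C φ)
    {e : ℝ} (he : √(∑ i, φ i ^ 2) ≤ e) (he1 : e < 1) :
    √(∑ i, ψ i ^ 2) * Real.cos (Real.pi / 2 * e) ≤
      √(∑ i, θ i ^ 2) * Real.cos (Real.pi / 2 * e) + e := by
  obtain ⟨p, hp⟩ := hAB.exists_perm_sum_sin_sq_le hd hAC hBC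
  have hpi := Real.pi_pos
  have he0 : 0 ≤ e := (Real.sqrt_nonneg _).trans he
  have hsum : ∑ i, Real.sin (θ i - ψ (p i)) ^ 2 ≤ e ^ 2 := by
    refine hp.trans (le_trans (Finset.sum_le_sum fun i _ => ?_) (Real.sqrt_le_iff.1 he).2)
    exact sq_le_sq.2 (Real.abs_sin_le_abs)
  set c := Real.cos (Real.pi / 2 * e) with hc
  have hc0 : 0 ≤ c := Real.cos_nonneg_of_mem_Icc ⟨by nlinarith, by nlinarith⟩
  have hD : √(∑ i, (θ i - ψ (p i)) ^ 2) * c ≤ e := by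
    rw [← Real.sqrt_sq hc0, ← Real.sqrt_mul (by positivity)]
    refine Real.sqrt_le_iff.2 ⟨he0, le_trans ?_ hsum⟩
    rw [Finset.sum_mul]
    refine Finset.sum_le_sum fun i _ => ?_
    rw [← mul_pow, sq_le_sq, abs_mul, abs_of_nonneg hc0]
    refine abs_mul_cos_le_abs_sin (abs_le.2 ⟨?_, ?_⟩) ?_ he1
    · linarith [(hAB.1 i).1, (hAC.1 (p i)).2]
    · linarith [(hAB.1 i).2, (hAC.1 (p i)).1]
    · refine abs_le_of_sq_le_sq (le_trans ?_ hsum) he0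
      exact Finset.single_le_sum (f := fun i => Real.sin (θ i - ψ (p i)) ^ 2)
        (fun i _ => sq_nonneg _) (Finset.mem_univ i)
  rw [← Equiv.sum_comp p fun i => ψ i ^ 2]
  have := sqrt_sum_sq_le_add θ (fun i => θ i - ψ (p i)) (fun i => ψ (p i)) fun i => by
    simpa using abs_sub (θ i) (θ i - ψ (p i))
  nlinarith

theorem PrincipalPair.grassmann_triangle
    (hd : Module.finrank ℝ H = Fintype.card (ι ⊕ ι)) {A B C : Submodule ℝ H} {θ ψ φ : ι → ℝ}
    (hAB : PrincipalPair A B θ) (hBC : PrincipalPair B C φ) (hAC : PrincipalPair A C ψ) :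
    √(∑ i, ψ i ^ 2) ≤ √(∑ i, θ i ^ 2) + √(∑ i, φ i ^ 2) := by
  obtain ⟨G, hG0, hG1, hGu, hG⟩ := hBC.exists_geodesic hd
  set D := √(∑ i, φ i ^ 2) with hDdef
  have hD0 : 0 ≤ D := Real.sqrt_nonneg _
  have hangle : ∀ s, ∃ ω : ι → ℝ, PrincipalPair A (G s) ω := fun s => by
    obtain ⟨_, v, u, hv, hu, rfl, rfl, _⟩ := hAB
    obtain ⟨w, hw, hws⟩ := hGu s
    rw [← hws]
    exact exists_principalPair hv hw
  have hstep : ∀ n : ℕ, D < n → √(∑ i, ψ i ^ 2) * Real.cos (Real.pi / 2 * (D / n)) ≤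
      √(∑ i, θ i ^ 2) * Real.cos (Real.pi / 2 * (D / n)) + D := by
    intro n hn
    have hn0 : (0 : ℝ) < n := hD0.trans_lt hn
    have hnz : n ≠ 0 := by
      rintro rfl
      simp at hn0
    -- The induction starts after one segment: the claim at `G 0 = B` would compare `θ` with an
    -- arbitrary family `ω` of angles for the same pair.
    have hind : ∀ m : ℕ, ∀ ω : ι → ℝ, PrincipalPair A (G ((m + 1 : ℕ) / n)) ω →
        √(∑ i, ω i ^ 2) * Real.cos (Real.pi / 2 * (D / n)) ≤
          √(∑ i, θ i ^ 2) * Real.cos (Real.pi / 2 * (D / n)) + (m + 1 : ℕ) * (D / n) := by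
      have hseg : ∀ m : ℕ, PrincipalPair (G ((m : ℕ) / n)) (G ((m + 1 : ℕ) / n))
          (fun i => (1 / n : ℝ) * φ i) := fun m => by
        have h1 : ((m + 1 : ℕ) / n : ℝ) - (m : ℕ) / n = 1 / n := by
          push_cast
          ring
        have h2 := hG ((m : ℕ) / n) ((m + 1 : ℕ) / n) (by gcongr; simp) (by
          have : (1 / n : ℝ) ≤ 1 := by
            rw [div_le_one hn0]
            exact_mod_cast Nat.one_le_iff_ne_zero.2 hnz
          linarith)
        rwa [h1] at h2
      have hlen : √(∑ i, ((1 / n : ℝ) * φ i) ^ 2) ≤ D / n := by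
        simp_rw [mul_pow]
        rw [← Finset.mul_sum, Real.sqrt_mul (by positivity), Real.sqrt_sq (by positivity)]
        exact le_of_eq (by ring)
      have hlt : D / n < 1 := (div_lt_one hn0).2 hn
      intro m
      induction m with
      | zero =>
        intro ω hω
        have h0 := hseg 0
        simp only [Nat.cast_zero, zero_div, hG0] at h0
        have := hAB.sqrt_sum_sq_mul_cos_le hd hω h0 hlen hlt
        simpa using this
      | succ m ih =>
        intro ω hω
        obtain ⟨ω', hω'⟩ := hangle ((m + 1 : ℕ) / n)
        have h1 := hω'.sqrt_sum_sq_mul_cos_le hd hω (hseg (m + 1)) hlen hlt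
        have h2 := ih ω' hω'
        have h3 : (((m + 1 + 1 : ℕ) : ℝ)) * (D / n) = (m + 1 : ℕ) * (D / n) + D / n := by
          push_cast
          ring
        linarith
    obtain ⟨m, rfl⟩ := Nat.exists_eq_succ_of_ne_zero hnz
    have h := hind m ψ (by rwa [div_self hn0.ne', hG1])
    rwa [mul_div_cancel₀ D hn0.ne'] at h
  have hlim : Tendsto (fun n : ℕ => Real.cos (Real.pi / 2 * (D / n))) atTop (𝓝 1) := by
    have h0 : Tendsto (fun n : ℕ => Real.pi / 2 * (D / n)) atTop (𝓝 0) := by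
      simpa using (tendsto_const_div_atTop_nhds_zero_nat D).const_mul (Real.pi / 2)
    simpa [Function.comp_def] using (Real.continuous_cos.tendsto 0).comp h0
  have hl := hlim.const_mul (√(∑ i, ψ i ^ 2))
  have hr := (hlim.const_mul (√(∑ i, θ i ^ 2))).add_const D
  rw [mul_one] at hl hr
  refine le_of_tendsto_of_tendsto hl hr ?_
  filter_upwards [eventually_gt_atTop ⌈D⌉₊] with n hn
  exact hstep n ((Nat.le_ceil D).trans_lt (by exact_mod_cast hn))

end GrassmannTriangle

/-! ### Reduction to equal dimensions. -/

section Augmentation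

variable {E : Type*} [NormedAddCommGroup E] [InnerProductSpace ℝ E]

/-- The first copy of `V ≤ F` in `F ⊕ F`. -/
noncomputable def firstCopy {F V : Submodule ℝ E} (h : V ≤ F) : V →ₗ[ℝ] WithLp 2 (F × F) :=
  (WithLp.linearEquiv 2 ℝ (F × F)).symm.toLinearMap ∘ₗ LinearMap.inl ℝ F F ∘ₗ Submodule.inclusion h

theorem inner_firstCopy {F V U : Submodule ℝ E} (hV : V ≤ F) (hU : U ≤ F) (x : V) (y : U) :
    ⟪firstCopy hV x, firstCopy hU y⟫ = ⟪(x : E), (y : E)⟫ := by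
  simp [firstCopy, WithLp.prod_inner_apply]

variable {F V U : Submodule ℝ E} [FiniteDimensional ℝ F]

/-- The standard orthonormal family of the second summand of `F ⊕ F`. -/
noncomputable def secondCopy (F : Submodule ℝ E) [FiniteDimensional ℝ F]
    (i : Fin (Module.finrank ℝ F)) : WithLp 2 (F × F) :=
  WithLp.toLp 2 (0, stdOrthonormalBasis ℝ F i)

theorem inner_secondCopy (i j : Fin (Module.finrank ℝ F)) :
    ⟪secondCopy F i, secondCopy F j⟫ = if i = j then 1 else 0 := by
  simp [secondCopy, WithLp.prod_inner_apply,
    orthonormal_iff_ite.1 (stdOrthonormalBasis ℝ F).orthonormal i j]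

theorem inner_firstCopy_secondCopy (hV : V ≤ F) (x : V) (j : Fin (Module.finrank ℝ F)) :
    ⟪firstCopy hV x, secondCopy F j⟫ = 0 := by
  simp [firstCopy, secondCopy, WithLp.prod_inner_apply]

/-- The subspace `V` of `F`, enlarged inside `F ⊕ F` to a subspace of dimension `dim F` by the
basis vectors of the second summand with index at least `dim V`. -/
noncomputable def augmentation (h : V ≤ F) : Submodule ℝ (WithLp 2 (F × F)) :=
  LinearMap.range (firstCopy h) ⊔
    Submodule.span ℝ (secondCopy F '' {i | Module.finrank ℝ V ≤ i})

/-- The basis of the augmentation of `V` that extends a given basis of `V`. -/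
noncomputable def augmentedFrame (h : V ≤ F) (v : Fin (Module.finrank ℝ V) → V)
    (i : Fin (Module.finrank ℝ F)) : WithLp 2 (F × F) :=
  if hi : (i : ℕ) < Module.finrank ℝ V then firstCopy h (v ⟨i, hi⟩) else secondCopy F i

theorem span_augmentedFrame (h : V ≤ F)
    (v : OrthonormalBasis (Fin (Module.finrank ℝ V)) ℝ V) :
    Submodule.span ℝ (Set.range (augmentedFrame h v)) = augmentation h := by
  have hle : Module.finrank ℝ V ≤ Module.finrank ℝ F := Submodule.finrank_mono h
  apply le_antisymm
  · rw [Submodule.span_le]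
    rintro _ ⟨i, rfl⟩
    simp only [augmentedFrame]
    split_ifs with hi
    · exact Submodule.mem_sup_left ⟨_, rfl⟩
    · exact Submodule.mem_sup_right (Submodule.subset_span ⟨i, not_lt.1 hi, rfl⟩)
  · refine sup_le ?_ (Submodule.span_le.2 ?_)
    · rintro _ ⟨x, rfl⟩
      rw [← v.sum_repr x, map_sum]
      refine Submodule.sum_mem _ fun i _ => ?_
      rw [map_smul]
      refine Submodule.smul_mem _ _ (Submodule.subset_span ⟨⟨i, i.2.trans_le hle⟩, ?_⟩)
      simp [augmentedFrame]
    · rintro _ ⟨i, hi, rfl⟩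
      exact Submodule.subset_span ⟨i, by simp [augmentedFrame, not_lt.2 hi.out]⟩

/-- Principal angles padded by right angles for the excess dimensions, and then by zeros. -/
noncomputable def paddedAngle (a : ℕ → ℝ) (k l i : ℕ) : ℝ :=
  if i < k ∧ i < l then a i else if k ≤ i ∧ l ≤ i then 0 else Real.pi / 2

/-- The two copies of `F` are orthogonal, so an index below just one of the dimensions gives a right
angle; an index beyond both gives the same added vector twice, hence angle zero. -/
theorem inner_augmentedFrame (hV : V ≤ F) (hU : U ≤ F) (v : Fin (Module.finrank ℝ V) → V)
    (u : Fin (Module.finrank ℝ U) → U) {a : ℕ → ℝ}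
    (h : ∀ i j, ⟪(v i : E), (u j : E)⟫ = if (i : ℕ) = j then Real.cos (a i) else 0)
    (i j : Fin (Module.finrank ℝ F)) :
    ⟪augmentedFrame hV v i, augmentedFrame hU u j⟫ = if i = j then
      Real.cos (paddedAngle a (Module.finrank ℝ V) (Module.finrank ℝ U) i) else 0 := by
  simp only [augmentedFrame, paddedAngle]
  by_cases hi : (i : ℕ) < Module.finrank ℝ V <;> by_cases hj : (j : ℕ) < Module.finrank ℝ U
  · rw [dif_pos hi, dif_pos hj, inner_firstCopy, h]
    by_cases hij : i = j
    · subst hij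
      simp [hi, hj]
    · simp [hij, Fin.val_inj]
  · rw [dif_pos hi, dif_neg hj, inner_firstCopy_secondCopy]
    by_cases hij : i = j
    · subst hij
      simp [hi, hj, hi.not_ge]
    · simp [hij]
  · rw [dif_neg hi, dif_pos hj, real_inner_comm, inner_firstCopy_secondCopy]
    by_cases hij : i = j
    · subst hij
      simp [hi, hj, hj.not_ge]
    · simp [hij]
  · rw [dif_neg hi, dif_neg hj, inner_secondCopy]
    by_cases hij : i = j
    · subst hij
      simp [hi, hj, not_lt.1 hi, not_lt.1 hj]
    · simp [hij]

theorem orthonormal_augmentedFrame (h : V ≤ F)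
    (v : OrthonormalBasis (Fin (Module.finrank ℝ V)) ℝ V) :
    Orthonormal ℝ (augmentedFrame h v) := by
  rw [orthonormal_iff_ite]
  intro i j
  -- Orthonormality is the case of a subspace paired with itself, with all angles zero.
  rw [inner_augmentedFrame h h v v (a := 0) fun i j => by
    rw [orthonormal_iff_ite.1 v.orthonormal_coe]
    simp [Fin.ext_iff]]
  have : paddedAngle 0 (Module.finrank ℝ V) (Module.finrank ℝ V) i = 0 := by
    rcases lt_or_ge (i : ℕ) (Module.finrank ℝ V) with hi | hi
    · simp [paddedAngle, hi]
    · simp [paddedAngle, hi, not_lt.2 hi]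
  rw [this, Real.cos_zero]

theorem principalPair_augmentation [FiniteDimensional ℝ V] [FiniteDimensional ℝ U]
    (hV : V ≤ F) (hU : U ≤ F) :
    PrincipalPair (augmentation hV) (augmentation hU)
      (fun i : Fin (Module.finrank ℝ F) => paddedAngle
        (fun i => Real.arccos
          ((U.orthogonalProjectionOnto.toLinearMap ∘ₗ V.subtype).singularValues i))
        (Module.finrank ℝ V) (Module.finrank ℝ U) i) := by
  obtain ⟨v, u, h⟩ := Submodule.exists_principalVectors V U
  set T := U.orthogonalProjectionOnto.toLinearMap ∘ₗ V.subtype with hT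
  refine ⟨fun i => ?_, augmentedFrame hV v, augmentedFrame hU u, orthonormal_augmentedFrame hV v,
    orthonormal_augmentedFrame hU u, span_augmentedFrame hV v, span_augmentedFrame hU u,
    inner_augmentedFrame hV hU v u fun i j => ?_⟩
  · simp only [paddedAngle]
    split_ifs
    · exact arccos_mem_of_nonneg (T.singularValues_nonneg _)
    · exact ⟨le_rfl, by positivity⟩
    · exact ⟨by positivity, le_rfl⟩
  · rw [h, Real.cos_arccos (by linarith [T.singularValues_nonneg i])
      (singularValues_projection_le_one V U i)]

theorem sum_paddedAngle {g : ℝ → ℝ} (hg : g 0 = 0) (a : ℕ → ℝ) {k l n : ℕ} (hk : k ≤ n)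
    (hl : l ≤ n) : ∑ i : Fin n, g (paddedAngle a k l i) =
      |(k : ℝ) - l| * g (Real.pi / 2) + ∑ i ∈ Finset.range (min k l), g (a i) := by
  wlog hkl : k ≤ l generalizing k l
  · have h := this hl hk (le_of_not_ge hkl)
    rw [min_comm, abs_sub_comm, ← h]
    refine Finset.sum_congr rfl fun i _ => ?_
    simp only [paddedAngle, and_comm]
  have hkl' : (k : ℝ) ≤ l := by exact_mod_cast hkl
  rw [Fin.sum_univ_eq_sum_range (fun i => g (paddedAngle a k l i)) n, Finset.range_eq_Ico,
    ← Finset.sum_Ico_consecutive _ (Nat.zero_le l) hl,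
    ← Finset.sum_Ico_consecutive _ (Nat.zero_le k) hkl, min_eq_left hkl,
    abs_of_nonpos (by linarith), Finset.range_eq_Ico]
  have h1 : ∑ i ∈ Finset.Ico 0 k, g (paddedAngle a k l i) = ∑ i ∈ Finset.Ico 0 k, g (a i) := by
    refine Finset.sum_congr rfl fun i hi => ?_
    have := (Finset.mem_Ico.1 hi).2
    rw [paddedAngle, if_pos ⟨this, this.trans_le hkl⟩]
  have h2 : ∑ i ∈ Finset.Ico k l, g (paddedAngle a k l i) =
      ∑ i ∈ Finset.Ico k l, g (Real.pi / 2) := by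
    refine Finset.sum_congr rfl fun i hi => ?_
    have := Finset.mem_Ico.1 hi
    rw [paddedAngle, if_neg (by omega), if_neg (by omega)]
  have h3 : ∑ i ∈ Finset.Ico l n, g (paddedAngle a k l i) = 0 := by
    refine Finset.sum_eq_zero fun i hi => ?_
    have := Finset.mem_Ico.1 hi
    rw [paddedAngle, if_neg (by omega), if_pos (by omega), hg]
  rw [h1, h2, h3, Finset.sum_const, Nat.card_Ico, nsmul_eq_mul, Nat.cast_sub hkl]
  ring

end Augmentation

/-! ### From triangle inequalities to metrics. -/

section Metrics

theorem finrank_withLp_prod_self {E : Type*} [NormedAddCommGroup E] [InnerProductSpace ℝ E]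
    (F : Submodule ℝ E) [FiniteDimensional ℝ F] : Module.finrank ℝ (WithLp 2 (F × F)) =
      Fintype.card (Fin (Module.finrank ℝ F) ⊕ Fin (Module.finrank ℝ F)) := by
  rw [(WithLp.linearEquiv 2 ℝ (F × F)).finrank_eq, Module.finrank_prod]
  simp

/-- Angle zero forces singular value `1`, so matching principal vectors coincide by equality in
Cauchy–Schwarz. -/
theorem GrInf.eq_of_principalAngle_eq_zero {V U : GrInf} (hdim : V.dim = U.dim)
    (h : ∀ i < V.dim, principalAngle V U i = 0) : V = U := by
  obtain ⟨v, u, hvu⟩ := Submodule.exists_principalVectors V.space U.space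
  refine GrInf.ext (Submodule.eq_of_le_of_finrank_eq ?_ hdim)
  rw [← v.span_coe, Submodule.span_le]
  rintro _ ⟨i, rfl⟩
  have hi := hvu i ⟨i, i.2.trans_eq hdim⟩
  have h1 : 1 ≤ (V.crossProj U).singularValues i := Real.arccos_eq_zero.1 (h i i.2)
  rw [if_pos rfl] at hi
  have h2 : ⟪(v i : RInf), (u ⟨i, i.2.trans_eq hdim⟩ : RInf)⟫ = 1 :=
    hi.trans (le_antisymm (singularValues_projection_le_one V.space U.space i) h1)
  have heq := (inner_eq_one_iff_of_norm_eq_one (𝕜 := ℝ) (v.orthonormal_coe.1 i)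
    (u.orthonormal_coe.1 _)).1 h2
  change (v i : RInf) ∈ U.space
  rw [show (v i : RInf) = _ from heq]
  exact Submodule.coe_mem _

/-- A function of the principal angles whose root sum over pairs of half-dimensional subspaces
satisfies the triangle inequality induces a metric on `Gr(∞, ∞)`. -/
theorem isMetric_of_principalAngle (g : ℝ → ℝ) (d : GrInf → GrInf → ℝ)
    (hd : ∀ V U, d V U = √(|(V.dim : ℝ) - U.dim| * g (Real.pi / 2) +
      ∑ i ∈ Finset.range (min V.dim U.dim), g (principalAngle V U i)))
    (hg0 : g 0 = 0) (hg : ∀ x, 0 ≤ x → x ≤ Real.pi / 2 → x ≠ 0 → 0 < g x)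
    (htri : ∀ (F : Submodule ℝ RInf) [FiniteDimensional ℝ F]
      (A B C : Submodule ℝ (WithLp 2 (F × F))) (θ φ ψ : Fin (Module.finrank ℝ F) → ℝ),
      PrincipalPair A B θ → PrincipalPair B C φ → PrincipalPair A C ψ →
        √(∑ i, g (ψ i)) ≤ √(∑ i, g (θ i)) + √(∑ i, g (φ i))) :
    IsMetric d := by
  have hang : ∀ V U i, 0 ≤ principalAngle V U i ∧ principalAngle V U i ≤ Real.pi / 2 :=
    fun V U i => arccos_mem_of_nonneg ((V.crossProj U).singularValues_nonneg i)
  have hgnn : ∀ V U i, 0 ≤ g (principalAngle V U i) := fun V U i => by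
    rcases eq_or_ne (principalAngle V U i) 0 with h | h
    · rw [h, hg0]
    · exact (hg _ (hang V U i).1 (hang V U i).2 h).le
  have hpi : 0 < g (Real.pi / 2) := hg _ (by positivity) le_rfl (by positivity)
  have hdF : ∀ (F : Submodule ℝ RInf) [FiniteDimensional ℝ F] (V U : GrInf), V.space ≤ F →
      U.space ≤ F → d V U = √(∑ i : Fin (Module.finrank ℝ F),
        g (paddedAngle (principalAngle V U) V.dim U.dim i)) := fun F _ V U hV hU => by
    have hk : V.dim ≤ Module.finrank ℝ F := Submodule.finrank_mono hV
    have hl : U.dim ≤ Module.finrank ℝ F := Submodule.finrank_mono hU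
    rw [hd, sum_paddedAngle hg0 _ hk hl]
  have hpair : ∀ (F : Submodule ℝ RInf) [FiniteDimensional ℝ F] (V U : GrInf)
      (hV : V.space ≤ F) (hU : U.space ≤ F), PrincipalPair (augmentation hV) (augmentation hU)
        (fun i : Fin (Module.finrank ℝ F) =>
          paddedAngle (principalAngle V U) V.dim U.dim i) := fun F _ V U hV hU =>
    principalPair_augmentation hV hU
  have hzero : ∀ (F : Submodule ℝ RInf) [FiniteDimensional ℝ F] (V : GrInf) (hV : V.space ≤ F),
      PrincipalPair (augmentation hV) (augmentation hV)
        (fun _ : Fin (Module.finrank ℝ F) => (0 : ℝ)) := fun F _ V hV => by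
    rw [← span_augmentedFrame hV (stdOrthonormalBasis ℝ V.space)]
    exact PrincipalPair.refl_zero (orthonormal_augmentedFrame hV _)
  have hsymm : ∀ V U, d V U ≤ d U V := fun V U => by
    have hV : V.space ≤ V.space ⊔ U.space := le_sup_left
    have hU : U.space ≤ V.space ⊔ U.space := le_sup_right
    -- Symmetry comes from a degenerate triangle: reverse the angles from `U` to `V`, then use zero
    -- angles from `U` to itself.
    have := htri _ _ _ _ _ _ _ (hpair _ U V hU hV).symm (hzero _ U hU) (hpair _ V U hV hU)
    rw [hdF _ V U hV hU, hdF _ U V hU hV]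
    simpa [hg0] using this
  refine ⟨fun V U => ?_, fun V U => ⟨fun h => ?_, ?_⟩, fun V U => le_antisymm (hsymm V U)
    (hsymm U V), fun V U W => ?_⟩
  · rw [hd]
    exact Real.sqrt_nonneg _
  · have hS : 0 ≤ ∑ i ∈ Finset.range (min V.dim U.dim), g (principalAngle V U i) :=
      Finset.sum_nonneg fun i _ => hgnn V U i
    rw [hd, Real.sqrt_eq_zero (by positivity)] at h
    obtain ⟨h1, h2⟩ := (add_eq_zero_iff_of_nonneg (by positivity) hS).1 h
    have hdim : V.dim = U.dim := by
      have := (mul_eq_zero.1 h1).resolve_right hpi.ne'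
      exact_mod_cast sub_eq_zero.1 (abs_eq_zero.1 this)
    refine GrInf.eq_of_principalAngle_eq_zero hdim fun i hi => ?_
    have h3 := (Finset.sum_eq_zero_iff_of_nonneg fun i _ => hgnn V U i).1 h2 i
      (by simpa [← hdim] using hi)
    by_contra hne
    exact (hg _ (hang V U i).1 (hang V U i).2 hne).ne' h3
  · rintro rfl
    have hV : V.space ≤ V.space := le_rfl
    have := htri _ _ _ _ _ _ _ (hzero _ V hV) (hzero _ V hV) (hpair _ V V hV hV)
    rw [← hdF _ V V hV hV] at this
    refine le_antisymm (by simpa [hg0] using this) ?_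
    rw [hd]
    exact Real.sqrt_nonneg _
  · have hV : V.space ≤ V.space ⊔ U.space ⊔ W.space := le_sup_left.trans le_sup_left
    have hU : U.space ≤ V.space ⊔ U.space ⊔ W.space := le_sup_right.trans le_sup_left
    have hW : W.space ≤ V.space ⊔ U.space ⊔ W.space := le_sup_right
    rw [hdF _ V W hV hW, hdF _ V U hV hU, hdF _ U W hU hW]
    exact htri _ _ _ _ _ _ _ (hpair _ V U hV hU) (hpair _ U W hU hW) (hpair _ V W hV hW)

theorem isMetric_chordalDist : IsMetric chordalDist := by
  refine isMetric_of_principalAngle (fun x => Real.sin x ^ 2) _ (fun V U => ?_) (by simp)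
    (fun x h0 h1 hne => ?_) fun F _ A B C θ φ ψ hAB hBC hAC =>
      hAB.chordal_triangle (finrank_withLp_prod_self F) hBC hAC
  · simp [chordalDist]
  · have := Real.sin_pos_of_pos_of_lt_pi (lt_of_le_of_ne h0 hne.symm)
      (by linarith [Real.pi_pos])
    positivity

theorem isMetric_grassmannDist : IsMetric grassmannDist := by
  refine isMetric_of_principalAngle (fun x => x ^ 2) _ (fun V U => ?_) (by simp)
    (fun x h0 h1 hne => by positivity) fun F _ A B C θ φ ψ hAB hBC hAC =>
      hAB.grassmann_triangle (finrank_withLp_prod_self F) hBC hAC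
  rw [grassmannDist, div_pow]
  norm_num

theorem isMetric_procrustesDist : IsMetric procrustesDist := by
  refine isMetric_of_principalAngle (fun x => 2 * Real.sin (x / 2) ^ 2) _ (fun V U => ?_)
    (by simp) (fun x h0 h1 hne => ?_) fun F _ A B C θ φ ψ hAB hBC hAC =>
      hAB.procrustes_triangle hBC hAC
  -- A right angle contributes exactly `1`, the weight of each excess dimension.
  · have h : 2 * Real.sin (Real.pi / 2 / 2) ^ 2 = 1 := by
      rw [div_div]
      norm_num [div_pow]
    simp only [h, mul_one]
    rw [procrustesDist, Finset.mul_sum]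
  · have hx := lt_of_le_of_ne h0 hne.symm
    have := Real.sin_pos_of_pos_of_lt_pi (x := x / 2) (by linarith)
      (by linarith [Real.pi_pos])
    positivity

theorem IsMetric.restrict {X : Type} {d : X → X → ℝ} (h : IsMetric d) (S : Set X) :
    IsMetric fun x y : S => d x y :=
  ⟨fun x y => h.nonneg x y, fun x y => (h.eq_zero_iff x y).trans Subtype.coe_inj,
    fun x y => h.symm x y, fun x y z => h.triangle x y z⟩

end Metrics

theorem theorem1 :
    (∀ d : GrInf → GrInf → ℝ, IsMetric d →
      IsMetric (fun V U : Lfh => d (V : GrInf) (U : GrInf))) ∧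
    IsMetric (fun V U : Lfh => chordalDist (V : GrInf) (U : GrInf)) ∧
    IsMetric (fun V U : Lfh => grassmannDist (V : GrInf) (U : GrInf)) ∧
    IsMetric (fun V U : Lfh => procrustesDist (V : GrInf) (U : GrInf)) := by
  exact ⟨fun d h => h.restrict Lfh, isMetric_chordalDist.restrict Lfh,
    isMetric_grassmannDist.restrict Lfh, isMetric_procrustesDist.restrict Lfh⟩
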